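/- Let $c<-2$ be real, let $f_c(z)=z^2+c$ on $\mathbb C$, write $f_c^{*n}$ for its $n$-th iterate, and let $J(f_c)$ be its Julia set, i.e. the boundary of the set of points of $\mathbb C$ with bounded forward orbit. Let $A$ be the complex vector space of germs along $J(f_c)$ of functions analytic in a complex neighbourhood of $J(f_c)$ (two functions are identified if they agree on some neighbourhood of $J(f_c)$), and let $L_c:A\to A$ be the Ruelle operator $$(L_cg)(x)=\sum_{y:\,f_c(y)=x}\frac{g(y)}{[f_c'(y)]^2}.$$ Then $f_c^{*n}(0)\ne 0$ for all $n\ge 1$, the series $$D_c(\lambda)=1+\sum_{n=1}^{\infty}\frac{\lambda^n}{2^n f_c(0)f_c^{*2}(0)\cdots f_c^{*n}(0)}$$ converges absolutely for every $\lambda\in\mathbb C$, and for every $\lambda\in\mathbb C\setminus\{0\}$ the number $\lambda^{-1}$ is an eigenvalue of $L_c:A\to A$ if and only if $D_c(\lambda)=0$. -/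

import Mathlib

open Filter Topology Set

noncomputable section

namespace RuelleQuadratic

/-- The quadratic polynomial `f_c(z) = z² + c`, with real parameter `c`. -/
def quad (c : ℝ) (z : ℂ) : ℂ := z ^ 2 + (c : ℂ)

/-- The filled Julia set of `f_c`: the points with bounded forward orbit. -/
def filledJulia (c : ℝ) : Set ℂ :=
  {z | Bornology.IsBounded (range fun n : ℕ => (quad c)^[n] z)}

/-- The Julia set `J(f_c)`: the boundary of the filled Julia set. -/
def julia (c : ℝ) : Set ℂ := frontier (filledJulia c)

/-- The Ruelle transfer operator on functions, with weight `(f_c')⁻²`: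
`(L_c g)(x) = ∑_{y : f_c(y) = x} g(y) / f_c'(y)²`. -/
def transfer (c : ℝ) (g : ℂ → ℂ) (x : ℂ) : ℂ :=
  ∑ᶠ y ∈ {y : ℂ | quad c y = x}, g y / (deriv (quad c) y) ^ 2

/-! ### The dynamical facts that make `L_c` well defined on germs along the Julia set -/

theorem differentiable_quad (c : ℝ) : Differentiable ℂ (quad c) := by
  unfold quad; fun_prop

theorem continuous_quad (c : ℝ) : Continuous (quad c) := (differentiable_quad c).continuous

theorem deriv_quad (c : ℝ) (y : ℂ) : deriv (quad c) y = 2 * y := by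
  have h : HasDerivAt (quad c) (((2 : ℕ) : ℂ) * y ^ (2 - 1)) y :=
    (hasDerivAt_pow 2 y).add_const (c : ℂ)
  simpa using h.deriv

theorem isOpenMap_quad (c : ℝ) : IsOpenMap (quad c) := by
  have h : AnalyticOnNhd ℂ (quad c) univ := fun z _ => (differentiable_quad c).analyticAt z
  rcases h.is_constant_or_isOpenMap with ⟨w, hw⟩ | h
  · exfalso
    have h0 := hw 0
    have h1 := hw 1
    rw [← h0] at h1
    simp [quad] at h1
  · exact h

theorem isClosedMap_quad (c : ℝ) : IsClosedMap (quad c) := by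
  have h : IsProperMap (quad c) := by
    rw [isProperMap_iff_tendsto_cocompact]
    refine ⟨continuous_quad c, ?_⟩
    rw [← Metric.cobounded_eq_cocompact, ← comap_norm_atTop, tendsto_comap_iff]
    have hlow : ∀ z : ℂ, ‖z‖ ^ 2 + (-|c|) ≤ ‖quad c z‖ := by
      intro z
      have := norm_sub_norm_le (z ^ 2) (-(c : ℂ))
      simp only [norm_pow, norm_neg, Complex.norm_real, Real.norm_eq_abs, sub_neg_eq_add] at this
      unfold quad
      linarith
    refine tendsto_atTop_mono hlow ?_
    refine tendsto_atTop_add_const_right _ _ ?_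
    exact (tendsto_pow_atTop (two_ne_zero)).comp tendsto_comap
  exact h.isClosedMap

theorem preimage_filledJulia (c : ℝ) : quad c ⁻¹' filledJulia c = filledJulia c := by
  ext z
  have h : (range fun n : ℕ => (quad c)^[n] z)
      = insert z (range fun n : ℕ => (quad c)^[n] (quad c z)) := by
    ext w
    constructor
    · rintro ⟨n, rfl⟩
      cases n with
      | zero => exact Or.inl rfl
      | succ n => exact Or.inr ⟨n, rfl⟩
    · rintro (rfl | ⟨n, rfl⟩)
      · exact ⟨0, rfl⟩
      · exact ⟨n + 1, rfl⟩
  simp only [filledJulia, mem_preimage, mem_ofPred_eq]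
  rw [h, Bornology.isBounded_insert]

/-- The Julia set is completely invariant. -/
theorem preimage_julia (c : ℝ) : quad c ⁻¹' julia c = julia c := by
  unfold julia
  rw [(isOpenMap_quad c).preimage_frontier_eq_frontier_preimage (continuous_quad c),
    preimage_filledJulia]

/-- For `c < -2` every point of modulus larger than `|c|` escapes to infinity. -/
theorem notMem_filledJulia_of_lt {c : ℝ} (hc : c < -2) {z : ℂ} (hz : -c < ‖z‖) :
    z ∉ filledJulia c := by
  have step : ∀ w : ℂ, -c < ‖w‖ → ‖w‖ + (‖w‖ + c) ≤ ‖quad c w‖ := by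
    intro w hw
    have := norm_sub_norm_le (w ^ 2) (-(c : ℂ))
    simp only [norm_pow, norm_neg, Complex.norm_real, Real.norm_eq_abs, sub_neg_eq_add,
      abs_of_neg (show c < 0 by linarith)] at this
    unfold quad
    nlinarith
  have grow : ∀ n : ℕ, ‖z‖ + n * (‖z‖ + c) ≤ ‖(quad c)^[n] z‖ := by
    intro n
    induction n with
    | zero => simp
    | succ n ih =>
      rw [Function.iterate_succ_apply']
      have hn : 0 ≤ (n : ℝ) * (‖z‖ + c) := mul_nonneg (Nat.cast_nonneg n) (by linarith)
      have := step ((quad c)^[n] z) (by linarith)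
      push_cast
      linarith
  intro hmem
  replace hmem : Bornology.IsBounded (range fun n : ℕ => (quad c)^[n] z) := hmem
  obtain ⟨R, hR⟩ := isBounded_iff_forall_norm_le.1 hmem
  obtain ⟨n, hn⟩ := exists_nat_gt (R / (‖z‖ + c))
  rw [div_lt_iff₀ (by linarith)] at hn
  have h1 := grow n
  have h2 := hR _ ⟨n, rfl⟩
  have h3 := norm_nonneg z
  linarith

/-- For `c < -2` the critical point `0` is not in the Julia set. -/
theorem zero_notMem_julia {c : ℝ} (hc : c < -2) : (0 : ℂ) ∉ julia c := by
  have hopen : IsOpen {z : ℂ | -c < ‖quad c (quad c z)‖} :=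
    isOpen_lt continuous_const ((continuous_quad c).comp (continuous_quad c)).norm
  have h0 : (0 : ℂ) ∈ {z : ℂ | -c < ‖quad c (quad c z)‖} := by
    have : quad c (quad c 0) = ((c ^ 2 + c : ℝ) : ℂ) := by simp [quad]
    rw [mem_ofPred_eq, this, Complex.norm_real, Real.norm_eq_abs]
    refine lt_of_lt_of_le ?_ (le_abs_self _)
    nlinarith
  intro h
  obtain ⟨z, hz, hzK⟩ := mem_closure_iff.1 (frontier_subset_closure h) _ hopen h0
  have h2 : quad c (quad c z) ∉ filledJulia c := notMem_filledJulia_of_lt hc hz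
  have h1 : quad c z ∈ filledJulia c := by
    rw [← preimage_filledJulia] at hzK; exact hzK
  rw [← preimage_filledJulia] at h1
  exact h2 h1

theorem fiber_eq {c : ℝ} {x s : ℂ} (hs : s ^ 2 = x - c) :
    {y : ℂ | quad c y = x} = {s, -s} := by
  ext y
  have h : quad c y = x ↔ y ^ 2 = s ^ 2 := by
    rw [hs]; unfold quad; exact eq_sub_iff_add_eq.symm
  simp only [mem_ofPred_eq, mem_insert_iff, mem_singleton_iff, h, sq_eq_sq_iff_eq_or_eq_neg]

theorem finite_fiber (c : ℝ) (x : ℂ) : {y : ℂ | quad c y = x}.Finite := by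
  obtain ⟨s, hs⟩ := IsAlgClosed.exists_pow_nat_eq (x - c) two_pos
  rw [fiber_eq hs]
  exact toFinite _

theorem transfer_add (c : ℝ) (g h : ℂ → ℂ) :
    transfer c (g + h) = transfer c g + transfer c h := by
  funext x
  simp only [transfer, Pi.add_apply, add_div]
  exact finsum_mem_add_distrib (finite_fiber c x)

theorem transfer_smul (c : ℝ) (a : ℂ) (g : ℂ → ℂ) :
    transfer c (a • g) = a • transfer c g := by
  funext x
  simp only [transfer, Pi.smul_apply]
  rw [smul_finsum_mem (finite_fiber c x)]
  simp only [smul_eq_mul, mul_div_assoc]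

theorem transfer_eq {c : ℝ} (g : ℂ → ℂ) {x s : ℂ} (hs : s ^ 2 = x - c) (h0 : s ≠ 0) :
    transfer c g x = g s / (2 * s) ^ 2 + g (-s) / (2 * -s) ^ 2 := by
  have hne : s ≠ -s := fun h => h0 (self_eq_neg.1 h)
  unfold transfer
  rw [fiber_eq hs, finsum_mem_pair hne, deriv_quad, deriv_quad]

/-- If two functions agree near the Julia set, so do their images under `L_c`. -/
theorem transfer_congr (c : ℝ) {g h : ℂ → ℂ} (H : g =ᶠ[𝓝ˢ (julia c)] h) :
    transfer c g =ᶠ[𝓝ˢ (julia c)] transfer c h := by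
  have hle : comap (quad c) (𝓝ˢ (julia c)) ≤ 𝓝ˢ (julia c) := by
    have := (isClosedMap_quad c).comap_nhdsSet_le (s := julia c)
    rwa [preimage_julia] at this
  obtain ⟨t, ht, hsub⟩ := mem_comap.1 (hle H)
  filter_upwards [ht] with x hx
  refine finsum_mem_congr rfl fun y hy => ?_
  have hy' : quad c y = x := hy
  have : g y = h y := hsub (show quad c y ∈ t by rwa [hy'])
  rw [this]

/-- `L_c` preserves analyticity along the Julia set. -/
theorem analyticOnNhd_transfer {c : ℝ} (hc : c < -2) {g : ℂ → ℂ}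
    (hg : AnalyticOnNhd ℂ g (julia c)) : AnalyticOnNhd ℂ (transfer c g) (julia c) := by
  intro x hx
  obtain ⟨s, hs⟩ := IsAlgClosed.exists_pow_nat_eq (x - c) two_pos
  have hqs : quad c s = x := by unfold quad; rw [hs]; ring
  have hqs' : quad c (-s) = x := by unfold quad; rw [neg_sq, hs]; ring
  have hsJ : s ∈ julia c := by rw [← preimage_julia, mem_preimage, hqs]; exact hx
  have hsJ' : -s ∈ julia c := by rw [← preimage_julia, mem_preimage, hqs']; exact hx
  have h0 : s ≠ 0 := by rintro rfl; exact zero_notMem_julia hc hsJ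
  have hs2 : s ^ 2 ≠ 0 := pow_ne_zero 2 h0
  -- the analytic local branch of the square root of `w - c` with value `s` at `x`
  set b : ℂ → ℂ := fun w => s * Complex.exp (Complex.log ((w - c) / s ^ 2) / 2) with hb
  have hone : (x - c) / s ^ 2 = 1 := by rw [← hs]; exact div_self hs2
  have hbx : b x = s := by simp [hb, hone]
  have hban : AnalyticAt ℂ b x := by
    have h1 : AnalyticAt ℂ (fun w : ℂ => (w - c) / s ^ 2) x := by fun_prop (disch := exact hs2)
    have h2 : AnalyticAt ℂ (fun w : ℂ => Complex.log ((w - c) / s ^ 2)) x :=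
      h1.clog (by rw [hone]; exact Complex.one_mem_slitPlane)
    exact analyticAt_const.mul ((h2.div analyticAt_const two_ne_zero).cexp)
  have hxc : x - c ≠ 0 := by rw [← hs]; exact hs2
  have hbne : ∀ w, b w ≠ 0 := fun w => mul_ne_zero h0 (Complex.exp_ne_zero _)
  have hev : ∀ᶠ w in 𝓝 x, w - (c : ℂ) ≠ 0 :=
    (continuous_id.sub continuous_const).continuousAt.eventually_ne hxc
  have heq : (fun w => g (b w) / (2 * b w) ^ 2 + g (-b w) / (2 * -b w) ^ 2)
      =ᶠ[𝓝 x] transfer c g := by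
    filter_upwards [hev] with w hw
    refine (transfer_eq g ?_ (hbne w)).symm
    rw [hb, mul_pow, ← Complex.exp_nat_mul]
    have : ((2 : ℕ) : ℂ) * (Complex.log ((w - c) / s ^ 2) / 2)
        = Complex.log ((w - c) / s ^ 2) := by push_cast; ring
    rw [this, Complex.exp_log (div_ne_zero hw hs2), mul_div_cancel₀ _ hs2]
  refine AnalyticAt.congr ?_ heq
  have hgs : AnalyticAt ℂ (fun w => g (b w)) x :=
    AnalyticAt.fun_comp (by rw [hbx]; exact hg s hsJ) hban
  have hgs' : AnalyticAt ℂ (fun w => g (-b w)) x :=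
    AnalyticAt.fun_comp (f := fun w => -b w) (by rw [hbx]; exact hg (-s) hsJ') hban.neg
  refine (hgs.div ((analyticAt_const.mul hban).pow 2) ?_).add
    (hgs'.div ((analyticAt_const.mul hban.neg).pow 2) ?_)
  · exact pow_ne_zero 2 (mul_ne_zero two_ne_zero (hbne x))
  · exact pow_ne_zero 2 (mul_ne_zero two_ne_zero (neg_ne_zero.2 (hbne x)))

/-! ### The space of analytic germs, the Ruelle operator, and the determinant -/

/-- Germs along the Julia set of functions analytic in a complex neighbourhood of it: two
functions are identified when they agree on some neighbourhood of the Julia set. -/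
def analyticGerms (c : ℝ) : Submodule ℂ (Germ (𝓝ˢ (julia c)) ℂ) where
  carrier := {φ | ∃ g : ℂ → ℂ, AnalyticOnNhd ℂ g (julia c) ∧ (g : Germ (𝓝ˢ (julia c)) ℂ) = φ}
  add_mem' := by
    rintro _ _ ⟨g, hg, rfl⟩ ⟨h, hh, rfl⟩
    exact ⟨g + h, hg.add hh, rfl⟩
  zero_mem' := ⟨0, fun _ _ => analyticAt_const, rfl⟩
  smul_mem' := by
    rintro a _ ⟨g, hg, rfl⟩
    exact ⟨a • g, fun x hx => analyticAt_const.smul (hg x hx), rfl⟩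

/-- The Ruelle operator on germs of arbitrary functions along the Julia set: the germ of `g` is
sent to the germ of `transfer c g`. -/
def germTransfer (c : ℝ) : Module.End ℂ (Germ (𝓝ˢ (julia c)) ℂ) where
  toFun := Germ.map' (transfer c) fun _ _ H => transfer_congr c H
  map_add' := by
    rintro ⟨g⟩ ⟨h⟩
    exact congrArg (fun u : ℂ → ℂ => (u : Germ (𝓝ˢ (julia c)) ℂ)) (transfer_add c g h)
  map_smul' := by
    rintro a ⟨g⟩
    exact congrArg (fun u : ℂ → ℂ => (u : Germ (𝓝ˢ (julia c)) ℂ)) (transfer_smul c a g)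

/-- The Ruelle operator `L_c` (for `c < -2`) acting on the space of analytic germs along the
Julia set. -/
def ruelle (c : ℝ) (hc : c < -2) : Module.End ℂ (analyticGerms c) :=
  (germTransfer c).restrict (by
    rintro _ ⟨g, hg, rfl⟩
    exact ⟨transfer c g, analyticOnNhd_transfer hc hg, rfl⟩)

/-- The `n`-th term `λⁿ / (2ⁿ f_c(0) f_c²(0) ⋯ f_cⁿ(0))` of the series `D_c(λ)`, where `f_cᵏ` is
the `k`-th iterate. -/
def detTerm (c : ℝ) (l : ℂ) (n : ℕ) : ℂ :=
  l ^ n / (2 ^ n * ∏ k ∈ Finset.Icc 1 n, (quad c)^[k] 0)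

/-- `D_c(λ) = 1 + ∑_{n ≥ 1} λⁿ / (2ⁿ f_c(0) ⋯ f_cⁿ(0))`. -/
def ruelleDet (c : ℝ) (l : ℂ) : ℂ := 1 + ∑' n : ℕ, detTerm c l (n + 1)

end RuelleQuadratic

end

/-!
# Eigenvalues of the Ruelle operator of `z² + c`, `c < -2`

Write `k_a(x) = 1 / (x - a)` and `c_j = f_c^{j+1}(0)`. A partial fraction computation gives
`L_c k_a = (k_{f_c(a)} - k_c) / (2a)` (`transfer_pole`), so that the series
`G = ∑ λ^j / (2^j c_0 ⋯ c_{j-1}) k_{c_j}` (`cauchySeries`) satisfies `λ L_c G = G - D_c(λ) k_c`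
(`smul_germTransfer_cauchySeries`). It is not the zero germ, as it has a pole at `c`; hence it is
an eigenfunction when `D_c(λ) = 0`.

Conversely, let `g` be an analytic germ with `λ L_c g = g`. For `h` holomorphic on `f_c⁻¹(V)`,
the function `L_c h` is holomorphic on `V` up to a multiple of `k_c`
(`transfer_eq_regTransfer_add`, `differentiableOn_regTransfer`). The sets `{|f_c^m| < R}` shrink
to the Julia set, because the filled Julia set has empty interior (`interior_filledJulia`,
`exists_preimage_ball_subset`), so `g = λ^m L_c^m g` shows that `g` is, on the disc `|x| < R`, the
sum of a holomorphic function and a combination of kernels `k_{c_j}` (`eigengerm_mem`). The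
kernels and the holomorphic functions are independent (`coeff_eq_zero_of_germ_eq_zero`), and
comparing coefficients in `λ L_c g = g` gives `g = u + b G` with `u` holomorphic on the disc
(`eigengerm_eq`). With `S u = L_c u - (u(0)/2) k_c`, the equation becomes
`u - λ S u = (λ u(0)/2 - b D_c(λ)) k_c`, and both sides vanish by independence. For large `R` the
operator `λ S` is a strict contraction by the maximum principle, so `u = 0`
(`toGerm_eq_zero_of_eq_regTransfer`). Therefore `b D_c(λ) = 0`, while `b ≠ 0` if `g ≠ 0`.
-/

namespace RuelleQuadratic

/-! ### Dynamics of `f_c` for `c < -2` -/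

theorem sq_norm_add_le_norm_quad {c : ℝ} (hc : c < 0) (z : ℂ) : ‖z‖ ^ 2 + c ≤ ‖quad c z‖ := by
  have := norm_sub_norm_le (z ^ 2) (-(c : ℂ))
  simp only [norm_pow, norm_neg, Complex.norm_real, Real.norm_eq_abs, sub_neg_eq_add,
    abs_of_neg hc] at this
  unfold quad
  linarith

theorem quad_neg (c : ℝ) (z : ℂ) : quad c (-z) = quad c z := by simp [quad]

theorem exists_fixedPoint_gt_two {c : ℝ} (hc : c < -2) : ∃ b : ℝ, 2 < b ∧ b ^ 2 + c = b := by
  have h0 : 0 ≤ 1 - 4 * c := by linarith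
  have h3 : 3 < √(1 - 4 * c) := Real.lt_sqrt_of_sq_lt (by linarith)
  refine ⟨(1 + √(1 - 4 * c)) / 2, by linarith, ?_⟩
  nlinarith [Real.sq_sqrt h0]

/-- The larger fixed point is the exact escape radius; the radius `-c` would be too large for
the expansion estimate in `interior_filledJulia`. -/
theorem norm_le_fixedPoint_of_mem_filledJulia {c b : ℝ} (hc : c < -2) (hb : 2 < b)
    (hfix : b ^ 2 + c = b) {z : ℂ} (hz : z ∈ filledJulia c) : ‖z‖ ≤ b := by
  by_contra! hlt
  have step : ∀ w : ℂ, b < ‖w‖ → ‖w‖ + (‖w‖ - b) ≤ ‖quad c w‖ := by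
    intro w hw
    have := sq_norm_add_le_norm_quad (show c < 0 by linarith) w
    nlinarith
  have grow : ∀ n : ℕ, ‖z‖ + n * (‖z‖ - b) ≤ ‖(quad c)^[n] z‖ := by
    intro n
    induction n with
    | zero => simp
    | succ n ih =>
      rw [Function.iterate_succ_apply']
      have hn : 0 ≤ (n : ℝ) * (‖z‖ - b) := mul_nonneg (Nat.cast_nonneg n) (by linarith)
      have := step ((quad c)^[n] z) (by linarith)
      push_cast
      linarith
  obtain ⟨R, hR⟩ := isBounded_iff_forall_norm_le.1
    (show Bornology.IsBounded (range fun n : ℕ => (quad c)^[n] z) from hz)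
  obtain ⟨n, hn⟩ := exists_nat_gt (R / (‖z‖ - b))
  rw [div_lt_iff₀ (by linarith)] at hn
  have h1 := grow n
  have h2 := hR _ ⟨n, rfl⟩
  have h3 := norm_nonneg z
  linarith

theorem mem_filledJulia_of_bound {c R : ℝ} {z : ℂ} (h : ∀ n : ℕ, ‖(quad c)^[n] z‖ ≤ R) :
    z ∈ filledJulia c := by
  have : Bornology.IsBounded (range fun n : ℕ => (quad c)^[n] z) := by
    refine isBounded_iff_forall_norm_le.2 ⟨R, ?_⟩
    rintro _ ⟨n, rfl⟩
    exact h n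
  exact this

theorem quad_mem_filledJulia_iff {c : ℝ} {z : ℂ} :
    quad c z ∈ filledJulia c ↔ z ∈ filledJulia c := by
  rw [← mem_preimage, preimage_filledJulia]

theorem iterate_mem_filledJulia_iff {c : ℝ} {z : ℂ} (n : ℕ) :
    (quad c)^[n] z ∈ filledJulia c ↔ z ∈ filledJulia c := by
  induction n with
  | zero => rfl
  | succ n ih => rw [Function.iterate_succ_apply', quad_mem_filledJulia_iff, ih]

theorem differentiable_iterate_quad (c : ℝ) (n : ℕ) : Differentiable ℂ (quad c)^[n] :=
  (differentiable_quad c).iterate n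

theorem mem_filledJulia_iff {c : ℝ} (hc : c < -2) {z : ℂ} :
    z ∈ filledJulia c ↔ ∀ n : ℕ, ‖(quad c)^[n] z‖ ≤ -c := by
  constructor
  · intro hz n
    by_contra! h
    exact notMem_filledJulia_of_lt hc h ((iterate_mem_filledJulia_iff n).2 hz)
  · exact mem_filledJulia_of_bound

theorem isClosed_filledJulia {c : ℝ} (hc : c < -2) : IsClosed (filledJulia c) := by
  have : filledJulia c = ⋂ n : ℕ, {z | ‖(quad c)^[n] z‖ ≤ -c} := by
    ext z
    simp only [mem_filledJulia_iff hc, mem_iInter, mem_ofPred_eq]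
  rw [this]
  exact isClosed_iInter fun n =>
    isClosed_le (differentiable_iterate_quad c n).continuous.norm continuous_const

theorem deriv_iterate_quad_succ (c : ℝ) (n : ℕ) (z : ℂ) :
    deriv (quad c)^[n + 1] z = 2 * (quad c)^[n] z * deriv (quad c)^[n] z := by
  rw [Function.iterate_succ', deriv_comp z (differentiable_quad c).differentiableAt
    (differentiable_iterate_quad c n).differentiableAt, deriv_quad]

/-- The filled Julia set has empty interior. With `b` the larger fixed point, `f_c` expands the
metric `|dz| / |b² - z²|^(1/2)` by at least `√2` on the filled Julia set; on an open subset of it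
the derivatives of the iterates would be bounded, which forces the orbit to converge to the
repelling point `b`, a contradiction. -/
theorem interior_filledJulia {c : ℝ} (hc : c < -2) : interior (filledJulia c) = ∅ := by
  obtain ⟨b, hb, hfix⟩ := exists_fixedPoint_gt_two hc
  rw [eq_empty_iff_forall_notMem]
  intro z hz
  obtain ⟨r, hr, hball⟩ := Metric.nhds_basis_closedBall.mem_iff.1 (mem_interior_iff_mem_nhds.1 hz)
  have hzK : z ∈ filledJulia c := interior_subset hz
  set o : ℕ → ℂ := fun n => (quad c)^[n] z with ho
  set d : ℕ → ℂ := fun n => deriv (quad c)^[n] z with hd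
  have hoK : ∀ n, o n ∈ filledJulia c := fun n => (iterate_mem_filledJulia_iff n).2 hzK
  have hosucc : ∀ n, o (n + 1) = o n ^ 2 + c := fun n => by
    simp only [ho, Function.iterate_succ_apply', quad]
  have hdsucc : ∀ n, d (n + 1) = 2 * o n * d n := fun n => deriv_iterate_quad_succ c n z
  -- Cauchy's estimate bounds the derivatives of the iterates.
  have hdbd : ∀ n, ‖d n‖ ≤ b / r := fun n =>
    Complex.norm_deriv_le_of_forall_mem_sphere_norm_le hr
      (differentiable_iterate_quad c n).diffContOnCl fun w hw =>
        norm_le_fixedPoint_of_mem_filledJulia hc hb hfix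
          ((iterate_mem_filledJulia_iff n).2 (hball (Metric.sphere_subset_closedBall hw)))
  have hlow : ∀ n, b ^ 2 - 2 * b ≤ ‖o n‖ ^ 2 := by
    intro n
    have h1 := norm_le_fixedPoint_of_mem_filledJulia hc hb hfix (hoK (n + 1))
    have h2 : ‖(c : ℂ)‖ - ‖o n ^ 2‖ ≤ ‖(c : ℂ) + o n ^ 2‖ := by
      have := norm_sub_norm_le (c : ℂ) (-(o n ^ 2))
      rwa [norm_neg, sub_neg_eq_add] at this
    rw [hosucc, add_comm] at h1
    rw [norm_pow, Complex.norm_real, Real.norm_eq_abs, abs_of_neg (by linarith)] at h2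
    nlinarith
  have hone : ∀ n, o n ≠ 0 := by
    intro n h
    have := hlow n
    rw [h] at this
    simp only [norm_zero] at this
    nlinarith
  have hdne : ∀ n, d n ≠ 0 := by
    intro n
    induction n with
    | zero => simp [hd]
    | succ n ih =>
      rw [hdsucc]
      exact mul_ne_zero (mul_ne_zero two_ne_zero (hone n)) ih
  have hfixC : (b : ℂ) ^ 2 + c = b := by exact_mod_cast hfix
  -- The expansion estimate, in multiplied-out form.
  have hexp : ∀ n, 2 ^ n * ‖(b : ℂ) ^ 2 - o n ^ 2‖ ≤ ‖(b : ℂ) ^ 2 - o 0 ^ 2‖ * ‖d n‖ ^ 2 := by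
    intro n
    induction n with
    | zero => simp [hd]
    | succ n ih =>
      have hfac : (b : ℂ) ^ 2 - o (n + 1) ^ 2
          = ((b : ℂ) ^ 2 - o n ^ 2) * (o n ^ 2 - ((b ^ 2 - 2 * b : ℝ) : ℂ)) := by
        rw [hosucc, eq_sub_of_add_eq' hfixC]
        push_cast
        ring
      have h2 : ‖o n ^ 2 - ((b ^ 2 - 2 * b : ℝ) : ℂ)‖ ≤ 2 * ‖o n‖ ^ 2 := by
        refine (norm_sub_le _ _).trans ?_
        rw [norm_pow, Complex.norm_real, Real.norm_eq_abs, abs_of_nonneg (by nlinarith)]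
        linarith [hlow n]
      rw [hfac, hdsucc, norm_mul]
      simp only [norm_mul, Complex.norm_ofNat]
      calc 2 ^ (n + 1) * (‖(b : ℂ) ^ 2 - o n ^ 2‖ * ‖o n ^ 2 - ((b ^ 2 - 2 * b : ℝ) : ℂ)‖)
          ≤ 2 ^ (n + 1) * (‖(b : ℂ) ^ 2 - o n ^ 2‖ * (2 * ‖o n‖ ^ 2)) := by gcongr
        _ = (2 ^ n * ‖(b : ℂ) ^ 2 - o n ^ 2‖) * (4 * ‖o n‖ ^ 2) := by ring
        _ ≤ (‖(b : ℂ) ^ 2 - o 0 ^ 2‖ * ‖d n‖ ^ 2) * (4 * ‖o n‖ ^ 2) := by gcongr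
        _ = _ := by ring
  have htend : Tendsto (fun n => ‖(b : ℂ) - o (n + 1)‖) atTop (𝓝 0) := by
    have hC : Tendsto (fun n : ℕ => ‖(b : ℂ) ^ 2 - o 0 ^ 2‖ * (b / r) ^ 2 * (1 / 2 : ℝ) ^ n)
        atTop (𝓝 0) := by
      simpa using (tendsto_pow_atTop_nhds_zero_of_lt_one (by norm_num : (0 : ℝ) ≤ 1 / 2)
        (by norm_num)).const_mul (‖(b : ℂ) ^ 2 - o 0 ^ 2‖ * (b / r) ^ 2)
    refine squeeze_zero (fun n => norm_nonneg _) (fun n => ?_) hC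
    have heq : (b : ℂ) - o (n + 1) = (b : ℂ) ^ 2 - o n ^ 2 := by
      rw [hosucc]; linear_combination -hfixC
    rw [heq, one_div, inv_pow, ← div_eq_mul_inv, le_div_iff₀ (by positivity), mul_comm]
    refine (hexp n).trans ?_
    gcongr
    exact hdbd n
  obtain ⟨N, hN⟩ := eventually_atTop.1 (htend.eventually (gt_mem_nhds one_pos))
  -- Near the fixed point the derivative at least doubles at each step.
  have hdouble : ∀ k, 2 ^ k * ‖d (N + 1)‖ ≤ ‖d (N + 1 + k)‖ := by
    intro k
    induction k with
    | zero => simp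
    | succ k ih =>
      have h1 := hN (N + k) (by lia)
      have h2 : 1 ≤ ‖o (N + k + 1)‖ := by
        have := norm_sub_norm_le (b : ℂ) (o (N + k + 1))
        rw [Complex.norm_real, Real.norm_eq_abs, abs_of_pos (by linarith)] at this
        have h1' : ‖(b : ℂ) - o (N + k + 1)‖ < 1 := h1
        linarith
      have hd2 : ‖d (N + 1 + (k + 1))‖ = 2 * ‖o (N + k + 1)‖ * ‖d (N + k + 1)‖ := by
        rw [show N + 1 + (k + 1) = (N + k + 1) + 1 by lia, hdsucc, norm_mul, norm_mul,
          Complex.norm_ofNat]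
      rw [show N + 1 + k = N + k + 1 by lia] at ih
      calc 2 ^ (k + 1) * ‖d (N + 1)‖ = 2 * 1 * (2 ^ k * ‖d (N + 1)‖) := by ring
        _ ≤ 2 * ‖o (N + k + 1)‖ * ‖d (N + k + 1)‖ := by gcongr
        _ = _ := hd2.symm
  have hpos : 0 < ‖d (N + 1)‖ := norm_pos_iff.2 (hdne _)
  obtain ⟨k, hk⟩ := pow_unbounded_of_one_lt (b / r / ‖d (N + 1)‖) (by norm_num : (1 : ℝ) < 2)
  rw [div_lt_iff₀ hpos] at hk
  linarith [hdouble k, hdbd (N + 1 + k)]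

theorem julia_eq_filledJulia {c : ℝ} (hc : c < -2) : julia c = filledJulia c := by
  rw [julia, (isClosed_filledJulia hc).frontier_eq, interior_filledJulia hc, sdiff_empty]

theorem julia_nonempty {c : ℝ} (hc : c < -2) : (julia c).Nonempty := by
  obtain ⟨b, -, hfix⟩ := exists_fixedPoint_gt_two hc
  have hb : quad c (b : ℂ) = b := by
    unfold quad
    exact_mod_cast hfix
  rw [julia_eq_filledJulia hc]
  exact ⟨b, mem_filledJulia_of_bound fun n => (congrArg norm (Function.iterate_fixed hb n)).le⟩

theorem norm_le_of_mem_julia {c : ℝ} (hc : c < -2) {z : ℂ} (hz : z ∈ julia c) : ‖z‖ ≤ -c := by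
  rw [julia_eq_filledJulia hc] at hz
  exact (mem_filledJulia_iff hc).1 hz 0

theorem preimage_ball_subset {c R : ℝ} (hc : c < -2) (hR : -c < R) :
    quad c ⁻¹' Metric.ball 0 R ⊆ Metric.ball 0 R := by
  intro y hy
  rw [mem_preimage, mem_ball_zero_iff] at hy
  have := sq_norm_add_le_norm_quad (show c < 0 by linarith) y
  rw [mem_ball_zero_iff]
  by_contra! h
  nlinarith

/-- The sublevel sets `{|f_c^m| < R}` shrink to the Julia set. -/
theorem exists_preimage_ball_subset {c R : ℝ} (hc : c < -2) (hR : -c < R) {U : Set ℂ}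
    (hU : IsOpen U) (hJ : julia c ⊆ U) :
    ∃ m : ℕ, (quad c)^[m] ⁻¹' Metric.ball 0 R ⊆ U := by
  have hanti : Antitone fun m : ℕ => {z : ℂ | ‖(quad c)^[m] z‖ ≤ R} := by
    refine antitone_nat_of_succ_le fun m z hz => ?_
    simp only [mem_ofPred_eq, Function.iterate_succ_apply'] at hz ⊢
    by_contra! h
    have := sq_norm_add_le_norm_quad (show c < 0 by linarith) ((quad c)^[m] z)
    nlinarith
  have hclosed : ∀ m : ℕ, IsClosed {z : ℂ | ‖(quad c)^[m] z‖ ≤ R} := fun m =>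
    isClosed_le (differentiable_iterate_quad c m).continuous.norm continuous_const
  have hcpt : ∀ m : ℕ, IsCompact {z : ℂ | ‖(quad c)^[m] z‖ ≤ R} := fun m =>
    (isCompact_closedBall (0 : ℂ) R).of_isClosed_subset (hclosed m) fun z hz => by
      simpa using hanti (Nat.zero_le m) hz
  obtain ⟨m, hm⟩ := exists_subset_nhds_of_isCompact (directed_of_isDirected_le fun _ _ h => hanti h)
    hcpt (U := U) (fun z hz => hU.mem_nhds (hJ (by
      rw [julia_eq_filledJulia hc]
      exact mem_filledJulia_of_bound fun n => mem_iInter.1 hz n)))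
  refine ⟨m, fun z hz => hm ?_⟩
  have : ‖(quad c)^[m] z‖ < R := by simpa using hz
  exact this.le

/-! ### The critical orbit -/

/-- The critical orbit `f_c(0), f_c²(0), …`, indexed from `0`. -/
def crit (c : ℝ) (j : ℕ) : ℂ := (quad c)^[j + 1] 0

theorem crit_zero (c : ℝ) : crit c 0 = c := by simp [crit, quad]

theorem crit_succ (c : ℝ) (j : ℕ) : crit c (j + 1) = quad c (crit c j) :=
  Function.iterate_succ_apply' _ _ _

theorem mul_norm_le_norm_quad {c : ℝ} (hc : c < -2) {z : ℂ} (hz : -c ≤ ‖z‖) :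
    (-c - 1) * ‖z‖ ≤ ‖quad c z‖ := by
  have := sq_norm_add_le_norm_quad (show c < 0 by linarith) z
  nlinarith

theorem neg_le_norm_crit {c : ℝ} (hc : c < -2) (j : ℕ) : -c ≤ ‖crit c j‖ := by
  induction j with
  | zero => rw [crit_zero, Complex.norm_real, Real.norm_eq_abs]; exact neg_le_abs c
  | succ j ih =>
    rw [crit_succ]
    have := mul_norm_le_norm_quad hc ih
    nlinarith

theorem strictMono_norm_crit {c : ℝ} (hc : c < -2) : StrictMono fun j => ‖crit c j‖ := by
  refine strictMono_nat_of_lt_succ fun j => ?_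
  have h1 := neg_le_norm_crit hc j
  have := mul_norm_le_norm_quad hc h1
  rw [crit_succ]
  nlinarith

theorem crit_injective {c : ℝ} (hc : c < -2) : Function.Injective (crit c) := fun _ _ h =>
  (strictMono_norm_crit hc).injective (congrArg norm h)

theorem crit_ne_zero {c : ℝ} (hc : c < -2) (j : ℕ) : crit c j ≠ 0 := by
  intro h
  have := neg_le_norm_crit hc j
  rw [h, norm_zero] at this
  linarith

theorem tendsto_norm_crit {c : ℝ} (hc : c < -2) : Tendsto (fun j => ‖crit c j‖) atTop atTop := by
  have hgeo : ∀ j, (-c - 1) ^ j ≤ ‖crit c j‖ := by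
    intro j
    induction j with
    | zero =>
      have := neg_le_norm_crit hc 0
      rw [pow_zero]
      linarith
    | succ j ih =>
      rw [crit_succ, pow_succ']
      exact (mul_le_mul_of_nonneg_left ih (by linarith)).trans
        (mul_norm_le_norm_quad hc (neg_le_norm_crit hc j))
  exact tendsto_atTop_mono hgeo (tendsto_pow_atTop_atTop_of_one_lt (by linarith))

theorem crit_notMem_julia {c : ℝ} (hc : c < -2) (j : ℕ) : crit c j ∉ julia c := by
  rw [julia_eq_filledJulia hc]
  intro h
  refine notMem_filledJulia_of_lt hc ?_ (quad_mem_filledJulia_iff.2 h)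
  rw [← crit_succ]
  exact (neg_le_norm_crit hc j).trans_lt (strictMono_norm_crit hc (Nat.lt_succ_self j))

/-- Every point off the critical orbit has positive distance to it. -/
theorem exists_pos_le_norm_sub_crit {c : ℝ} (hc : c < -2) {z : ℂ} (hz : ∀ j, z ≠ crit c j) :
    ∃ δ > 0, ∀ j, δ ≤ ‖z - crit c j‖ := by
  have ht : Tendsto (fun j => ‖z - crit c j‖) cofinite atTop := by
    rw [Nat.cofinite_eq_atTop]
    refine tendsto_atTop_mono (fun j => ?_)
      (tendsto_atTop_add_const_right _ (-‖z‖) (tendsto_norm_crit hc))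
    have := norm_sub_norm_le (crit c j) z
    rw [norm_sub_rev] at this
    linarith
  obtain ⟨i, hi⟩ := ht.exists_forall_le
  exact ⟨_, norm_pos_iff.2 (sub_ne_zero.2 (hz i)), hi⟩

theorem eventually_ne_crit {c : ℝ} (hc : c < -2) :
    ∀ᶠ z in 𝓝ˢ (julia c), ∀ j, z ≠ crit c j := by
  rw [eventually_nhdsSet_iff_forall]
  intro z hz
  obtain ⟨δ, hδ, h⟩ := exists_pos_le_norm_sub_crit hc
    (fun j (e : z = crit c j) => crit_notMem_julia hc j (e ▸ hz))
  filter_upwards [Metric.ball_mem_nhds z hδ] with w hw j hj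
  have h1 := h j
  rw [← hj, norm_sub_rev, ← dist_eq_norm] at h1
  exact absurd (Metric.mem_ball.1 hw) (not_lt.2 h1)

/-! ### The Ruelle operator with its pole at the critical value split off -/

/-- The sum of `h` over the two square roots of `x - c`, the root `0` being counted twice when
`x = c`. -/
noncomputable def fiberSum (c : ℝ) (h : ℂ → ℂ) (x : ℂ) : ℂ :=
  h ((x - c) ^ (((2 : ℕ) : ℂ)⁻¹)) + h (-(x - c) ^ (((2 : ℕ) : ℂ)⁻¹))

theorem fiberSum_eq {c : ℝ} (h : ℂ → ℂ) {x s : ℂ} (hs : s ^ 2 = x - c) :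
    fiberSum c h x = h s + h (-s) := by
  have h2 : ((x - c) ^ (((2 : ℕ) : ℂ)⁻¹)) ^ 2 = s ^ 2 := by
    rw [Complex.cpow_nat_inv_pow _ two_ne_zero, hs]
  unfold fiberSum
  rcases sq_eq_sq_iff_eq_or_eq_neg.1 h2 with e | e
  · rw [e]
  · rw [e, neg_neg, add_comm]

theorem fiberSum_self (c : ℝ) (h : ℂ → ℂ) : fiberSum c h c = 2 * h 0 := by
  rw [fiberSum_eq h (s := 0) (by simp), neg_zero, two_mul]

/-- Summing over the fibre preserves holomorphy, also across the branch point `c`: there the sum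
is continuous, so the singularity is removable. -/
theorem differentiableOn_fiberSum {c : ℝ} {h : ℂ → ℂ} {V : Set ℂ} (hV : IsOpen V)
    (hh : DifferentiableOn ℂ h (quad c ⁻¹' V)) : DifferentiableOn ℂ (fiberSum c h) V := by
  have hpre : IsOpen (quad c ⁻¹' V) := hV.preimage (continuous_quad c)
  have hat : ∀ {x s : ℂ}, x ∈ V → s ^ 2 = x - c → DifferentiableAt ℂ h s := by
    intro x s hx hs
    refine hh.differentiableAt (hpre.mem_nhds ?_)
    rwa [mem_preimage, quad, hs, sub_add_cancel]
  have hreg : ∀ x ∈ V, x ≠ c → DifferentiableAt ℂ (fiberSum c h) x := by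
    intro x hx hxc
    obtain ⟨s, hs⟩ := IsAlgClosed.exists_pow_nat_eq (x - c) two_pos
    have hs2 : s ^ 2 ≠ 0 := by rw [hs]; exact sub_ne_zero.2 hxc
    -- the local branch of the square root of `w - c` with value `s` at `x`
    set b : ℂ → ℂ := fun w => s * Complex.exp (Complex.log ((w - c) / s ^ 2) / 2) with hb
    have hone : (x - c) / s ^ 2 = 1 := by rw [← hs]; exact div_self hs2
    have hbx : b x = s := by simp [hb, hone]
    have hbd : DifferentiableAt ℂ b x := by
      have h2 : DifferentiableAt ℂ (fun w : ℂ => Complex.log ((w - c) / s ^ 2)) x :=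
        DifferentiableAt.clog (by fun_prop) (by rw [hone]; exact Complex.one_mem_slitPlane)
      exact ((h2.div_const 2).cexp).const_mul s
    have heq : (fun w => h (b w) + h (-b w)) =ᶠ[𝓝 x] fiberSum c h := by
      filter_upwards [isOpen_ne.mem_nhds hxc] with w hw
      refine (fiberSum_eq h ?_).symm
      have h2 : ((2 : ℕ) : ℂ) * (Complex.log ((w - c) / s ^ 2) / 2)
          = Complex.log ((w - c) / s ^ 2) := by push_cast; ring
      rw [hb, mul_pow, ← Complex.exp_nat_mul, h2,
        Complex.exp_log (div_ne_zero (sub_ne_zero.2 hw) hs2), mul_div_cancel₀ _ hs2]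
    refine DifferentiableAt.congr_of_eventuallyEq ?_ heq.symm
    have h1 : DifferentiableAt ℂ h (b x) := by rw [hbx]; exact hat hx hs
    have h2 : DifferentiableAt ℂ h (-b x) := by rw [hbx]; exact hat hx (by rw [neg_sq, hs])
    exact (h1.comp x hbd).add (DifferentiableAt.comp x h2 hbd.neg)
  by_cases hc : (c : ℂ) ∈ V
  · refine (Complex.differentiableOn_compl_singleton_and_continuousAt_iff (hV.mem_nhds hc)).1
      ⟨fun x hx => (hreg x hx.1 hx.2).differentiableWithinAt, ?_⟩
    have hsq : ContinuousAt (fun x : ℂ => (x - c) ^ (((2 : ℕ) : ℂ)⁻¹)) c := by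
      refine ContinuousAt.comp (f := fun x : ℂ => x - c)
        (g := fun x : ℂ => x ^ (((2 : ℕ) : ℂ)⁻¹)) ?_ (by fun_prop)
      refine Complex.continuousAt_cpow_const_of_re_pos (Or.inl (by simp)) ?_
      norm_num
    have h0 : ((c : ℂ) - c) ^ (((2 : ℕ) : ℂ)⁻¹) = 0 := by simp
    have hcont : ContinuousAt h 0 := (hat hc (by simp)).continuousAt
    refine ContinuousAt.add (ContinuousAt.comp ?_ hsq)
      (ContinuousAt.comp (f := fun x : ℂ => -(x - c) ^ (((2 : ℕ) : ℂ)⁻¹)) ?_ hsq.neg)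
    · rw [h0]; exact hcont
    · rw [h0, neg_zero]; exact hcont
  · exact fun x hx => (hreg x hx (fun e => hc (e ▸ hx))).differentiableWithinAt

/-- The part of `L_c h` that is holomorphic at the critical value `c`: away from `c` it is
`L_c h - (h(0)/2) / (x - c)`. If `c` lies outside the domain of interest, `h(0)` may be an arbitrary
value; the splitting remains valid there. -/
noncomputable def regTransfer (c : ℝ) (h : ℂ → ℂ) (x : ℂ) : ℂ :=
  dslope (fiberSum c h) c x / 4

theorem differentiableOn_regTransfer {c : ℝ} {h : ℂ → ℂ} {V : Set ℂ} (hV : IsOpen V)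
    (hh : DifferentiableOn ℂ h (quad c ⁻¹' V)) : DifferentiableOn ℂ (regTransfer c h) V := by
  have hF := differentiableOn_fiberSum hV hh
  refine DifferentiableOn.div_const ?_ 4
  by_cases hc : (c : ℂ) ∈ V
  · exact (Complex.differentiableOn_dslope (hV.mem_nhds hc)).2 hF
  · exact (differentiableOn_dslope_of_notMem hc).2 hF

theorem regTransfer_eq {c : ℝ} (h : ℂ → ℂ) {x s : ℂ} (hs : s ^ 2 = x - c) (hx : x ≠ c) :
    regTransfer c h x = (h s + h (-s) - 2 * h 0) / (4 * (x - c)) := by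
  have hxc : x - (c : ℂ) ≠ 0 := sub_ne_zero.2 hx
  rw [regTransfer, dslope_of_ne _ hx, slope_def_field, fiberSum_self, fiberSum_eq h hs]
  field_simp

/-- The Cauchy kernel `x ↦ (x - a)⁻¹` with pole `a`. -/
noncomputable def pole (a : ℂ) : ℂ → ℂ := fun x => (x - a)⁻¹

theorem differentiableOn_pole {a : ℂ} {V : Set ℂ} (ha : a ∉ V) : DifferentiableOn ℂ (pole a) V :=
  fun _ hx => (DifferentiableAt.inv (differentiableAt_id.sub_const a)
    (sub_ne_zero.2 (ne_of_mem_of_not_mem hx ha))).differentiableWithinAt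

theorem transfer_eq_regTransfer_add {c : ℝ} (h : ℂ → ℂ) {x : ℂ} (hx : x ≠ c) :
    transfer c h x = regTransfer c h x + h 0 / 2 * pole c x := by
  obtain ⟨s, hs⟩ := IsAlgClosed.exists_pow_nat_eq (x - c) two_pos
  have hxc : x - (c : ℂ) ≠ 0 := sub_ne_zero.2 hx
  have hs0 : s ≠ 0 := by
    rintro rfl
    exact hxc (by rw [← hs]; simp)
  rw [transfer_eq h hs hs0, regTransfer_eq h hs hx, pole, ← hs]
  field_simp
  ring

theorem transfer_pole {c : ℝ} {a x : ℂ} (ha : a ≠ 0) (hx : x ≠ c) (hxa : x ≠ quad c a) :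
    transfer c (pole a) x = (2 * a)⁻¹ * (pole (quad c a) x - pole c x) := by
  obtain ⟨s, hs⟩ := IsAlgClosed.exists_pow_nat_eq (x - c) two_pos
  have hs0 : s ≠ 0 := by
    rintro rfl
    exact sub_ne_zero.2 hx (by rw [← hs]; simp)
  have h3 : x - quad c a = (s - a) * (s + a) := by
    unfold quad
    linear_combination -hs
  have h4 : (s - a) * (s + a) ≠ 0 := h3 ▸ sub_ne_zero.2 hxa
  have h1 : s - a ≠ 0 := left_ne_zero_of_mul h4
  have h2 : s + a ≠ 0 := right_ne_zero_of_mul h4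
  have h5 : -s - a ≠ 0 := fun e => h2 (by linear_combination -e)
  simp only [transfer_eq _ hs hs0, pole]
  rw [h3, ← hs, show -s - a = -(s + a) by ring]
  field_simp
  ring

/-! ### Germs along the Julia set -/

/-- The germ of a function along the Julia set, as a linear map. -/
noncomputable def toGerm (c : ℝ) : (ℂ → ℂ) →ₗ[ℂ] Germ (𝓝ˢ (julia c)) ℂ where
  toFun g := (g : Germ (𝓝ˢ (julia c)) ℂ)
  map_add' _ _ := rfl
  map_smul' _ _ := rfl

theorem toGerm_eq_iff {c : ℝ} {g h : ℂ → ℂ} :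
    toGerm c g = toGerm c h ↔ g =ᶠ[𝓝ˢ (julia c)] h := Germ.coe_eq

theorem germTransfer_toGerm (c : ℝ) (g : ℂ → ℂ) :
    germTransfer c (toGerm c g) = toGerm c (transfer c g) := rfl

theorem germTransfer_eq_regTransfer {c : ℝ} (hc : c < -2) (h : ℂ → ℂ) :
    germTransfer c (toGerm c h)
      = toGerm c (regTransfer c h) + (h 0 / 2) • toGerm c (pole (crit c 0)) := by
  rw [germTransfer_toGerm, ← map_smul, ← map_add, toGerm_eq_iff]
  filter_upwards [eventually_ne_crit hc] with x hx
  have := hx 0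
  rw [crit_zero] at this ⊢
  exact transfer_eq_regTransfer_add h this

theorem germTransfer_pole {c : ℝ} (hc : c < -2) (j : ℕ) :
    germTransfer c (toGerm c (pole (crit c j))) = (2 * crit c j)⁻¹ •
      (toGerm c (pole (crit c (j + 1))) - toGerm c (pole (crit c 0))) := by
  rw [germTransfer_toGerm, ← map_sub, ← map_smul, toGerm_eq_iff]
  filter_upwards [eventually_ne_crit hc] with x hx
  have h0 := hx 0
  have h1 := hx (j + 1)
  rw [crit_succ] at h1 ⊢
  rw [crit_zero] at h0 ⊢
  exact transfer_pole (crit_ne_zero hc j) h0 h1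

/-- Germs along the Julia set of functions holomorphic on `V`. -/
noncomputable def regularGerms (c : ℝ) (V : Set ℂ) : Submodule ℂ (Germ (𝓝ˢ (julia c)) ℂ) :=
  Submodule.map (toGerm c)
    { carrier := {h | DifferentiableOn ℂ h V}
      add_mem' := fun hg hh => DifferentiableOn.add hg hh
      zero_mem' := differentiableOn_const 0
      smul_mem' := fun a _ hh => DifferentiableOn.const_smul hh a }

/-- The span of the Cauchy kernels with poles on the critical orbit. -/
noncomputable def poleGerms (c : ℝ) : Submodule ℂ (Germ (𝓝ˢ (julia c)) ℂ) :=
  Submodule.span ℂ (range fun j => toGerm c (pole (crit c j)))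

theorem toGerm_pole_mem (c : ℝ) (j : ℕ) : toGerm c (pole (crit c j)) ∈ poleGerms c :=
  Submodule.subset_span ⟨j, rfl⟩

/-- Applying `L_c` enlarges the domain from `f_c⁻¹(V)` to `V`, up to poles on the critical
orbit. -/
theorem germTransfer_mem {c : ℝ} (hc : c < -2) {V : Set ℂ} (hV : IsOpen V)
    {v : Germ (𝓝ˢ (julia c)) ℂ} (hv : v ∈ regularGerms c (quad c ⁻¹' V) ⊔ poleGerms c) :
    germTransfer c v ∈ regularGerms c V ⊔ poleGerms c := by
  suffices H : regularGerms c (quad c ⁻¹' V) ⊔ poleGerms c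
      ≤ (regularGerms c V ⊔ poleGerms c).comap (germTransfer c) from H hv
  refine sup_le ?_ (Submodule.span_le.2 ?_)
  · rintro _ ⟨h, hh, rfl⟩
    rw [Submodule.mem_comap, germTransfer_eq_regTransfer hc]
    exact add_mem (Submodule.mem_sup_left ⟨_, differentiableOn_regTransfer hV hh, rfl⟩)
      (Submodule.mem_sup_right (Submodule.smul_mem _ _ (toGerm_pole_mem c 0)))
  · rintro _ ⟨j, rfl⟩
    rw [SetLike.mem_coe, Submodule.mem_comap, germTransfer_pole hc]
    exact Submodule.mem_sup_right (Submodule.smul_mem _ _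
      (sub_mem (toGerm_pole_mem c _) (toGerm_pole_mem c 0)))

theorem germTransfer_pow_mem {c : ℝ} (hc : c < -2) {V : Set ℂ} (hV : IsOpen V) (m : ℕ)
    {v : Germ (𝓝ˢ (julia c)) ℂ}
    (hv : v ∈ regularGerms c ((quad c)^[m] ⁻¹' V) ⊔ poleGerms c) :
    (germTransfer c ^ m) v ∈ regularGerms c V ⊔ poleGerms c := by
  induction m generalizing v with
  | zero => exact hv
  | succ m ih =>
    rw [pow_succ, Module.End.mul_apply]
    refine ih (germTransfer_mem hc
      (hV.preimage (differentiable_iterate_quad c m).continuous) ?_)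
    rwa [Function.iterate_succ, preimage_comp] at hv

/-- An analytic eigengerm extends meromorphically to every disc, with poles on the critical
orbit. -/
theorem eigengerm_mem {c R : ℝ} (hc : c < -2) (hR : -c < R) {l : ℂ} (hl : l ≠ 0)
    {v : Germ (𝓝ˢ (julia c)) ℂ} (hv : v ∈ analyticGerms c) (heig : germTransfer c v = l⁻¹ • v) :
    v ∈ regularGerms c (Metric.ball 0 R) ⊔ poleGerms c := by
  obtain ⟨g, hg, rfl⟩ := hv
  obtain ⟨m, hm⟩ := exists_preimage_ball_subset hc hR (isOpen_analyticAt ℂ g) hg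
  have hreg : toGerm c g ∈ regularGerms c ((quad c)^[m] ⁻¹' Metric.ball 0 R) :=
    ⟨g, fun z hz => (hm hz).differentiableAt.differentiableWithinAt, rfl⟩
  have hmem := germTransfer_pow_mem hc Metric.isOpen_ball m (Submodule.mem_sup_left hreg)
  have hpow : ∀ n : ℕ, (germTransfer c ^ n) (toGerm c g) = (l⁻¹) ^ n • toGerm c g := by
    intro n
    induction n with
    | zero => simp
    | succ n ih =>
      rw [pow_succ', Module.End.mul_apply, ih, map_smul,
        show germTransfer c (toGerm c g) = l⁻¹ • toGerm c g from heig, smul_smul, pow_succ]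
  rw [hpow] at hmem
  exact (Submodule.smul_mem_iff _ (pow_ne_zero _ (inv_ne_zero hl))).1 hmem

/-- Kernels whose pole lies outside the disc are holomorphic on it, so only those with pole in
the disc need to be split off. -/
theorem exists_eq_regular_add_sum {c R : ℝ} {N : ℕ} (hN : ∀ j, N ≤ j → R ≤ ‖crit c j‖)
    {v : Germ (𝓝ˢ (julia c)) ℂ}
    (hv : v ∈ regularGerms c (Metric.ball 0 R) ⊔ poleGerms c) :
    ∃ h, DifferentiableOn ℂ h (Metric.ball 0 R) ∧ ∃ b : ℕ → ℂ,
      v = toGerm c h + ∑ j ∈ Finset.range N, b j • toGerm c (pole (crit c j)) := by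
  have hle : regularGerms c (Metric.ball 0 R) ⊔ poleGerms c ≤ regularGerms c (Metric.ball 0 R) ⊔
      Submodule.span ℂ ((fun j => toGerm c (pole (crit c j))) '' (Finset.range N : Set ℕ)) := by
    refine sup_le le_sup_left (Submodule.span_le.2 ?_)
    rintro _ ⟨j, rfl⟩
    by_cases hj : j < N
    · exact Submodule.mem_sup_right
        (Submodule.subset_span ⟨j, by simpa using hj, rfl⟩)
    · refine Submodule.mem_sup_left ⟨_, differentiableOn_pole ?_, rfl⟩
      simpa using hN j (not_lt.1 hj)
  obtain ⟨_, ⟨h, hh, rfl⟩, w, hw, rfl⟩ := Submodule.mem_sup.1 (hle hv)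
  obtain ⟨b, rfl⟩ := (Submodule.mem_span_image_finset_iff_exists_fun' ℂ).1 hw
  exact ⟨h, hh, b, rfl⟩

/-- Holomorphic functions on a disc containing the Julia set and the kernels with pole in the
disc are independent as germs along the Julia set. -/
theorem coeff_eq_zero_of_germ_eq_zero {c R : ℝ} (hc : c < -2) (hR : -c < R) {N : ℕ}
    (hN : ∀ j < N, ‖crit c j‖ < R) {h : ℂ → ℂ} (hh : DifferentiableOn ℂ h (Metric.ball 0 R))
    {e : ℕ → ℂ}
    (H : toGerm c h + ∑ j ∈ Finset.range N, e j • toGerm c (pole (crit c j)) = 0) :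
    ∀ j < N, e j = 0 := by
  -- clear denominators
  set Q : ℂ → ℂ := fun x => h x * ∏ i ∈ Finset.range N, (x - crit c i)
    + ∑ j ∈ Finset.range N, e j * ∏ i ∈ (Finset.range N).erase j, (x - crit c i) with hQ
  have hQd : DifferentiableOn ℂ Q (Metric.ball 0 R) := by
    refine (hh.mul (Differentiable.differentiableOn (by fun_prop))).add
      (Differentiable.differentiableOn (by fun_prop))
  have H' : (h + ∑ j ∈ Finset.range N, e j • pole (crit c j)) =ᶠ[𝓝ˢ (julia c)] 0 := by
    rw [← toGerm_eq_iff, map_add, map_sum, map_zero]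
    simpa only [map_smul] using H
  obtain ⟨z, hz⟩ := julia_nonempty hc
  have hzball : z ∈ Metric.ball (0 : ℂ) R := by
    simpa using (norm_le_of_mem_julia hc hz).trans_lt hR
  have hQ0 : Q =ᶠ[𝓝 z] 0 := by
    refine Filter.Eventually.filter_mono (nhds_le_nhdsSet hz) ?_
    filter_upwards [H', eventually_ne_crit hc] with x hx hne
    have hx' : h x = -∑ j ∈ Finset.range N, e j * (x - crit c j)⁻¹ := by
      simp only [Pi.add_apply, Finset.sum_apply, Pi.smul_apply, smul_eq_mul, Pi.zero_apply,
        pole] at hx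
      exact eq_neg_of_add_eq_zero_left hx
    rw [hQ]
    simp only [Pi.zero_apply]
    rw [hx', neg_mul, Finset.sum_mul, neg_add_eq_zero]
    refine Finset.sum_congr rfl fun j hj => ?_
    rw [← Finset.mul_prod_erase _ _ hj, mul_assoc,
      inv_mul_cancel_left₀ (sub_ne_zero.2 (hne j))]
  have hQzero : EqOn Q 0 (Metric.ball 0 R) :=
    (hQd.analyticOnNhd Metric.isOpen_ball).eqOn_zero_of_preconnected_of_eventuallyEq_zero
      (convex_ball 0 R).isPreconnected hzball hQ0
  intro k hk
  have hk' : k ∈ Finset.range N := Finset.mem_range.2 hk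
  have hval := hQzero (show crit c k ∈ Metric.ball (0 : ℂ) R by simpa using hN k hk)
  simp only [hQ, Pi.zero_apply] at hval
  rw [Finset.prod_eq_zero hk' (sub_self _), mul_zero, zero_add,
    Finset.sum_eq_single_of_mem k hk'] at hval
  · refine (mul_eq_zero.1 hval).resolve_right (Finset.prod_ne_zero_iff.2 fun i hi => ?_)
    exact sub_ne_zero.2 fun e => (Finset.mem_erase.1 hi).1 (crit_injective hc e.symm)
  · intro j _ hjk
    rw [Finset.prod_eq_zero (Finset.mem_erase.2 ⟨hjk.symm, hk'⟩) (sub_self _), mul_zero]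

/-! ### The determinant and the Cauchy series over the critical orbit -/

theorem detTerm_zero (c : ℝ) (l : ℂ) : detTerm c l 0 = 1 := by simp [detTerm]

theorem detTerm_succ (c : ℝ) (l : ℂ) (j : ℕ) :
    detTerm c l (j + 1) = l * (detTerm c l j * (2 * crit c j)⁻¹) := by
  rw [detTerm, detTerm, Finset.prod_Icc_succ_top (by lia), crit]
  simp only [div_eq_mul_inv, mul_inv, pow_succ]
  ring

theorem summable_norm_detTerm {c : ℝ} (hc : c < -2) (l : ℂ) :
    Summable fun j => ‖detTerm c l j‖ := by
  refine summable_of_ratio_norm_eventually_le (r := 1 / 2) (by norm_num) ?_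
  filter_upwards [(tendsto_norm_crit hc).eventually_ge_atTop ‖l‖] with j hj
  have hpos : 0 < ‖crit c j‖ := norm_pos_iff.2 (crit_ne_zero hc j)
  rw [detTerm_succ, norm_norm, norm_norm, norm_mul, norm_mul, norm_inv, norm_mul,
    Complex.norm_ofNat]
  calc ‖l‖ * (‖detTerm c l j‖ * (2 * ‖crit c j‖)⁻¹)
      ≤ ‖crit c j‖ * (‖detTerm c l j‖ * (2 * ‖crit c j‖)⁻¹) := by gcongr
    _ = 1 / 2 * ‖detTerm c l j‖ := by field_simp

theorem norm_mul_pole_le {e p x : ℂ} {δ : ℝ} (hδ : 0 < δ) (h : δ ≤ ‖x - p‖) :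
    ‖e * pole p x‖ ≤ ‖e‖ * δ⁻¹ := by
  rw [norm_mul, pole, norm_inv]
  gcongr

theorem summable_mul_pole {e p : ℕ → ℂ} (he : Summable fun j => ‖e j‖) {x : ℂ} {δ : ℝ}
    (hδ : 0 < δ) (h : ∀ j, δ ≤ ‖x - p j‖) : Summable fun j => e j * pole (p j) x :=
  Summable.of_norm_bounded (he.mul_right δ⁻¹) fun j => norm_mul_pole_le hδ (h j)

theorem differentiableAt_tsum_mul_pole {e p : ℕ → ℂ} (he : Summable fun j => ‖e j‖) {x : ℂ}
    {δ : ℝ} (hδ : 0 < δ) (h : ∀ j, δ ≤ ‖x - p j‖) :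
    DifferentiableAt ℂ (fun y => ∑' j, e j * pole (p j) y) x := by
  have hfar : ∀ j, ∀ y ∈ Metric.ball x (δ / 2), δ / 2 ≤ ‖y - p j‖ := by
    intro j y hy
    have h1 := norm_sub_le_norm_sub_add_norm_sub x y (p j)
    rw [Metric.mem_ball, dist_comm, dist_eq_norm] at hy
    linarith [h j]
  refine (Complex.differentiableOn_tsum_of_summable_norm (he.mul_right (δ / 2)⁻¹) (fun j => ?_)
    Metric.isOpen_ball fun j y hy => norm_mul_pole_le (half_pos hδ) (hfar j y hy)).differentiableAt
    (Metric.ball_mem_nhds x (half_pos hδ))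
  refine DifferentiableOn.const_mul (differentiableOn_pole fun hp => ?_) _
  have := hfar j _ hp
  rw [sub_self, norm_zero] at this
  linarith

/-- The solution of `(1 - λ L_c) G = D_c(λ) / (x - c)`; it is an eigenfunction when
`D_c(λ) = 0`. -/
noncomputable def cauchySeries (c : ℝ) (l : ℂ) (x : ℂ) : ℂ :=
  ∑' j, detTerm c l j * pole (crit c j) x

theorem analyticOnNhd_cauchySeries {c : ℝ} (hc : c < -2) (l : ℂ) :
    AnalyticOnNhd ℂ (cauchySeries c l) (julia c) := by
  intro x hx
  rw [Complex.analyticAt_iff_eventually_differentiableAt]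
  filter_upwards [(eventually_ne_crit hc).filter_mono (nhds_le_nhdsSet hx)] with y hy
  obtain ⟨δ, hδ, h⟩ := exists_pos_le_norm_sub_crit hc hy
  exact differentiableAt_tsum_mul_pole (summable_norm_detTerm hc l) hδ h

theorem mul_transfer_cauchySeries {c : ℝ} (hc : c < -2) (l : ℂ) {x : ℂ}
    (hx : ∀ j, x ≠ crit c j) :
    l * transfer c (cauchySeries c l) x
      = cauchySeries c l x - ruelleDet c l * pole (crit c 0) x := by
  have hsum : ∀ y : ℂ, (∀ j, y ≠ crit c j) →
      Summable fun j => detTerm c l j * pole (crit c j) y := by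
    intro y hy
    obtain ⟨δ, hδ, h⟩ := exists_pos_le_norm_sub_crit hc hy
    exact summable_mul_pole (summable_norm_detTerm hc l) hδ h
  obtain ⟨s, hs⟩ := IsAlgClosed.exists_pow_nat_eq (x - c) two_pos
  have hx0 : x ≠ c := by simpa only [crit_zero] using hx 0
  have hs0 : s ≠ 0 := by
    rintro rfl
    exact sub_ne_zero.2 hx0 (by rw [← hs]; simp)
  have hqs : quad c s = x := by rw [quad, hs, sub_add_cancel]
  have hsne : ∀ j, s ≠ crit c j := by
    rintro j rfl
    exact hx (j + 1) (by rw [crit_succ, hqs])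
  have hsne' : ∀ j, -s ≠ crit c j := fun j e =>
    hx (j + 1) (by rw [crit_succ, ← e, quad_neg, hqs])
  have hD := (summable_norm_detTerm hc l).of_norm
  have hterm : ∀ j, l * (detTerm c l j * pole (crit c j) s / (2 * s) ^ 2
      + detTerm c l j * pole (crit c j) (-s) / (2 * -s) ^ 2)
      = detTerm c l (j + 1) * pole (crit c (j + 1)) x
        - detTerm c l (j + 1) * pole (crit c 0) x := by
    intro j
    have h1 := transfer_pole (crit_ne_zero hc j) hx0 (by rw [← crit_succ]; exact hx (j + 1))
    rw [transfer_eq _ hs hs0, ← crit_succ] at h1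
    rw [detTerm_succ, crit_zero]
    linear_combination l * detTerm c l j * h1
  have hlhs : l * transfer c (cauchySeries c l) x
      = ∑' j, l * (detTerm c l j * pole (crit c j) s / (2 * s) ^ 2
        + detTerm c l j * pole (crit c j) (-s) / (2 * -s) ^ 2) := by
    rw [transfer_eq _ hs hs0, tsum_mul_left, Summable.tsum_add ((hsum s hsne).div_const _)
      ((hsum (-s) hsne').div_const _), tsum_div_const, tsum_div_const, cauchySeries, cauchySeries]
  rw [hlhs, tsum_congr hterm, Summable.tsum_sub
    ((summable_nat_add_iff 1).2 (hsum x hx)) (((summable_nat_add_iff 1).2 hD).mul_right _),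
    tsum_mul_right, cauchySeries, (hsum x hx).tsum_eq_zero_add, ruelleDet, detTerm_zero]
  ring

theorem smul_germTransfer_cauchySeries {c : ℝ} (hc : c < -2) (l : ℂ) :
    l • germTransfer c (toGerm c (cauchySeries c l))
      = toGerm c (cauchySeries c l) - ruelleDet c l • toGerm c (pole (crit c 0)) := by
  rw [germTransfer_toGerm, ← map_smul, ← map_smul, ← map_sub, toGerm_eq_iff]
  filter_upwards [eventually_ne_crit hc] with x hx
  exact mul_transfer_cauchySeries hc l hx

theorem exists_cauchySeries_eq {c R : ℝ} (hc : c < -2) {N : ℕ}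
    (hN : ∀ j, N ≤ j → R ≤ ‖crit c j‖) (l : ℂ) :
    ∃ t, DifferentiableOn ℂ t (Metric.ball 0 R) ∧ toGerm c (cauchySeries c l)
      = toGerm c t + ∑ j ∈ Finset.range N, detTerm c l j • toGerm c (pole (crit c j)) := by
  refine ⟨fun x => ∑' j, detTerm c l (j + N) * pole (crit c (j + N)) x, fun x hx => ?_, ?_⟩
  · have hx' : ‖x‖ < R := by simpa using hx
    refine (differentiableAt_tsum_mul_pole (e := fun j => detTerm c l (j + N))
      (p := fun j => crit c (j + N)) ((summable_nat_add_iff N).2 (summable_norm_detTerm hc l))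
      (sub_pos.2 hx') fun j => ?_).differentiableWithinAt
    have := norm_sub_norm_le (crit c (j + N)) x
    rw [norm_sub_rev] at this
    linarith [hN (j + N) (by lia)]
  · simp only [← map_smul]
    rw [← map_sum, ← map_add, toGerm_eq_iff]
    filter_upwards [eventually_ne_crit hc] with x hx
    obtain ⟨δ, hδ, h⟩ := exists_pos_le_norm_sub_crit hc hx
    rw [cauchySeries, ← (summable_mul_pole (summable_norm_detTerm hc l) hδ
      h).sum_add_tsum_nat_add N, add_comm]
    simp only [Pi.add_apply, Finset.sum_apply, Pi.smul_apply, smul_eq_mul]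

/-! ### The eigenvalue equation -/

theorem hasEigenvalue_ruelle_iff {c : ℝ} (hc : c < -2) (a : ℂ) :
    (ruelle c hc).HasEigenvalue a ↔
      ∃ v ∈ analyticGerms c, v ≠ 0 ∧ germTransfer c v = a • v := by
  constructor
  · intro h
    obtain ⟨v, hv⟩ := h.exists_hasEigenvector
    exact ⟨v, v.2, fun e => hv.2 (Subtype.ext e), congrArg Subtype.val hv.apply_eq_smul⟩
  · rintro ⟨v, hv, h0, he⟩
    refine Module.End.hasEigenvalue_of_hasEigenvector (x := ⟨v, hv⟩)
      (Module.End.hasEigenvector_iff.2 ⟨Module.End.mem_eigenspace_iff.2 (Subtype.ext he), ?_⟩)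
    exact fun e => h0 (congrArg Subtype.val e)

/-- On large discs `λ` times the regular part of `L_c` is a strict contraction, so it has no
nonzero fixed point. -/
theorem toGerm_eq_zero_of_eq_regTransfer {c R : ℝ} (hc : c < -2) {l : ℂ}
    (hR : ‖l‖ - c + 1 < R) {u : ℂ → ℂ} (hu : DifferentiableOn ℂ u (Metric.ball 0 R))
    (H : toGerm c u = l • toGerm c (regTransfer c u)) : u 0 = 0 ∧ toGerm c u = 0 := by
  have hl := norm_nonneg l
  set r : ℝ := ‖l‖ - c + 1 with hr
  have hsub : Metric.closedBall (0 : ℂ) r ⊆ Metric.ball 0 R := Metric.closedBall_subset_ball hR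
  have hroot : ∀ x s : ℂ, ‖x‖ ≤ r → s ^ 2 = x - c → ‖s‖ ≤ r := by
    intro x s hx hs
    have h1 : ‖s‖ ^ 2 ≤ r - c := by
      rw [← norm_pow, hs]
      refine (norm_sub_le _ _).trans ?_
      rw [Complex.norm_real, Real.norm_eq_abs, abs_of_neg (by linarith)]
      linarith
    by_contra! h
    nlinarith
  obtain ⟨z, hz⟩ := julia_nonempty hc
  have hJ : ∀ w ∈ julia c, ‖w‖ < r := fun w hw => by
    linarith [norm_le_of_mem_julia hc hw]
  have hfix : EqOn u (l • regTransfer c u) (Metric.ball 0 R) := by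
    rw [← map_smul, toGerm_eq_iff] at H
    exact (hu.analyticOnNhd Metric.isOpen_ball).eqOn_of_preconnected_of_eventuallyEq
      (((differentiableOn_regTransfer Metric.isOpen_ball
        (hu.mono (preimage_ball_subset hc (by linarith)))).const_smul l).analyticOnNhd
          Metric.isOpen_ball) (convex_ball 0 R).isPreconnected
      (hsub (by simpa using (hJ z hz).le)) (H.filter_mono (nhds_le_nhdsSet hz))
  obtain ⟨x₀, hx₀, hmax⟩ := (isCompact_closedBall (0 : ℂ) r).exists_isMaxOn
    ⟨0, by simp only [mem_closedBall_zero_iff, norm_zero]; linarith⟩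
    (hu.continuousOn.mono hsub).norm
  set M : ℝ := ‖u x₀‖ with hM
  have hbd : ∀ y : ℂ, ‖y‖ ≤ r → ‖u y‖ ≤ M := fun y hy => hmax (by simpa using hy)
  have hM0 : 0 ≤ M := norm_nonneg _
  have hsphere : ∀ x : ℂ, ‖x‖ = r → ‖u x‖ ≤ ‖l‖ / (‖l‖ + 1) * M := by
    intro x hx
    obtain ⟨s, hs⟩ := IsAlgClosed.exists_pow_nat_eq (x - c) two_pos
    have hdist : ‖l‖ + 1 ≤ ‖x - c‖ := by
      have := norm_sub_norm_le x (c : ℂ)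
      rw [hx, Complex.norm_real, Real.norm_eq_abs, abs_of_neg (by linarith)] at this
      linarith
    have hxc : x ≠ c := by
      rintro rfl
      rw [sub_self, norm_zero] at hdist
      linarith
    have hs1 := hbd s (hroot x s hx.le hs)
    have hs2 := hbd (-s) (by rw [norm_neg]; exact hroot x s hx.le hs)
    have h0 := hbd 0 (by rw [norm_zero]; linarith)
    have hnum : ‖u s + u (-s) - 2 * u 0‖ ≤ 4 * M := by
      refine (norm_sub_le _ _).trans ?_
      have := norm_add_le (u s) (u (-s))
      rw [norm_mul, Complex.norm_ofNat]
      linarith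
    rw [hfix (hsub (by simpa using hx.le)), Pi.smul_apply, regTransfer_eq u hs hxc, norm_smul,
      norm_div, norm_mul, Complex.norm_ofNat]
    calc ‖l‖ * (‖u s + u (-s) - 2 * u 0‖ / (4 * ‖x - c‖))
        ≤ ‖l‖ * (4 * M / (4 * (‖l‖ + 1))) := by gcongr
      _ = ‖l‖ / (‖l‖ + 1) * M := by field_simp
  have hall : ∀ x ∈ Metric.closedBall (0 : ℂ) r, ‖u x‖ ≤ ‖l‖ / (‖l‖ + 1) * M := by
    intro x hx
    have hr0 : r ≠ 0 := by linarith
    have hcl : closure (Metric.ball (0 : ℂ) r) = Metric.closedBall 0 r := closure_ball 0 hr0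
    refine Complex.norm_le_of_forall_mem_frontier_norm_le (U := Metric.ball (0 : ℂ) r)
      Metric.isBounded_ball (DifferentiableOn.diffContOnCl (by rw [hcl]; exact hu.mono hsub))
      (fun w hw => ?_) (by rwa [hcl])
    rw [frontier_ball 0 hr0] at hw
    exact hsphere w (by simpa using hw)
  have hMzero : M = 0 := by
    have h1 : M ≤ ‖l‖ / (‖l‖ + 1) * M := hall x₀ hx₀
    rw [div_mul_eq_mul_div, le_div_iff₀ (by linarith)] at h1
    linarith
  have hzero : ∀ y : ℂ, ‖y‖ ≤ r → u y = 0 := fun y hy =>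
    norm_le_zero_iff.1 ((hbd y hy).trans_eq hMzero)
  refine ⟨hzero 0 (by rw [norm_zero]; linarith), ?_⟩
  rw [← map_zero (toGerm c), toGerm_eq_iff]
  filter_upwards [Metric.isOpen_ball.mem_nhdsSet.2
    (show julia c ⊆ Metric.ball 0 r from fun w hw => by simpa using hJ w hw)] with w hw
  exact hzero w (by simpa using (mem_ball_zero_iff.1 hw).le)

theorem exists_radius_index {c : ℝ} (hc : c < -2) (R : ℝ) :
    ∃ N, (∀ j < N, ‖crit c j‖ < R) ∧ ∀ j, N ≤ j → R ≤ ‖crit c j‖ := by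
  classical
  have hex : ∃ j, R ≤ ‖crit c j‖ := ((tendsto_norm_crit hc).eventually_ge_atTop R).exists
  exact ⟨Nat.find hex, fun j hj => not_le.1 (Nat.find_min hex hj), fun j hj =>
    (Nat.find_spec hex).trans ((strictMono_norm_crit hc).monotone hj)⟩

theorem toGerm_cauchySeries_ne_zero {c : ℝ} (hc : c < -2) (l : ℂ) :
    toGerm c (cauchySeries c l) ≠ 0 := by
  intro h
  obtain ⟨N, hN1, hN2⟩ := exists_radius_index hc (-c + 1)
  obtain ⟨t, ht, heq⟩ := exists_cauchySeries_eq hc hN2 l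
  have hN : 0 < N := by
    by_contra hN
    have := hN2 0 (not_lt.1 hN)
    rw [crit_zero, Complex.norm_real, Real.norm_eq_abs, abs_of_neg (by linarith)] at this
    linarith
  have := coeff_eq_zero_of_germ_eq_zero hc (by linarith) hN1 ht (heq.symm.trans h) 0 hN
  rw [detTerm_zero] at this
  exact one_ne_zero this

/-- An eigenfunction has simple poles at the points of the critical orbit in a large disc, and
comparing residues in `λ L_c g = g` shows that they are proportional to those of the Cauchy
series. -/
theorem eigengerm_eq {c R : ℝ} (hc : c < -2) (hR : -c < R) {l : ℂ} (hl : l ≠ 0)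
    {v : Germ (𝓝ˢ (julia c)) ℂ} (hv : v ∈ analyticGerms c) (heig : germTransfer c v = l⁻¹ • v) :
    ∃ u, DifferentiableOn ℂ u (Metric.ball 0 R) ∧
      ∃ b : ℂ, v = toGerm c u + b • toGerm c (cauchySeries c l) := by
  obtain ⟨N, hN1, hN2⟩ := exists_radius_index hc R
  obtain ⟨h, hh, b, rfl⟩ := exists_eq_regular_add_sum hN2 (eigengerm_mem hc hR hl hv heig)
  obtain ⟨t, ht, heq⟩ := exists_cauchySeries_eq hc hN2 l
  rcases N with _ | M
  · exact ⟨h, hh, 0, by simp⟩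
  -- the coefficients `e` of the kernels in `(1 - λ L_c) v`, and its holomorphic part `w`
  set q : ℕ → ℂ := fun j => l * (b j * (2 * crit c j)⁻¹) with hq
  set e : ℕ → ℂ := fun j => Nat.casesOn j
    (b 0 - l * (h 0 / 2) + ∑ i ∈ Finset.range (M + 1), q i) fun i => b (i + 1) - q i
  have he0 : e 0 = b 0 - l * (h 0 / 2) + ∑ i ∈ Finset.range (M + 1), q i := rfl
  have hes : ∀ i, e (i + 1) = b (i + 1) - q i := fun _ => rfl
  set w : ℂ → ℂ := h - l • regTransfer c h - q M • pole (crit c (M + 1)) with hw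
  have hwd : DifferentiableOn ℂ w (Metric.ball 0 R) := by
    refine (hh.sub ((differentiableOn_regTransfer Metric.isOpen_ball
      (hh.mono (preimage_ball_subset hc hR))).const_smul l)).sub
        ((differentiableOn_pole ?_).const_smul _)
    simpa using hN2 (M + 1) le_rfl
  have hTsum : l • germTransfer c
      (∑ j ∈ Finset.range (M + 1), b j • toGerm c (pole (crit c j)))
      = ∑ j ∈ Finset.range M, q j • toGerm c (pole (crit c (j + 1)))
        + q M • toGerm c (pole (crit c (M + 1)))
        - (∑ j ∈ Finset.range (M + 1), q j) • toGerm c (pole (crit c 0)) := by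
    rw [← Finset.sum_range_succ (fun j => q j • toGerm c (pole (crit c (j + 1)))),
      Finset.sum_smul, ← Finset.sum_sub_distrib, map_sum, Finset.smul_sum]
    refine Finset.sum_congr rfl fun j _ => ?_
    rw [map_smul, germTransfer_pole hc, smul_smul, smul_smul]
    simp only [hq, smul_sub, mul_assoc]
  have hzero : toGerm c w + ∑ j ∈ Finset.range (M + 1), e j • toGerm c (pole (crit c j)) = 0 := by
    have h1 : l • germTransfer c (toGerm c h
        + ∑ j ∈ Finset.range (M + 1), b j • toGerm c (pole (crit c j)))
        = toGerm c h + ∑ j ∈ Finset.range (M + 1), b j • toGerm c (pole (crit c j)) := by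
      rw [heig, smul_smul, mul_inv_cancel₀ hl, one_smul]
    rw [map_add, smul_add, hTsum, germTransfer_eq_regTransfer hc,
      Finset.sum_range_succ' (fun j => b j • toGerm c (pole (crit c j)))] at h1
    rw [Finset.sum_range_succ', he0, hw, map_sub, map_sub, map_smul, map_smul]
    simp only [hes, sub_smul, Finset.sum_sub_distrib, add_smul]
    rw [← sub_eq_zero] at h1
    rw [← neg_eq_zero, ← h1, smul_add, smul_smul]
    abel
  have hcoef := coeff_eq_zero_of_germ_eq_zero hc hR hN1 hwd hzero
  have hb : ∀ j, j < M + 1 → b j = b 0 * detTerm c l j := by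
    intro j
    induction j with
    | zero => intro _; rw [detTerm_zero, mul_one]
    | succ j ih =>
      intro hj
      have h1 := hcoef (j + 1) hj
      rw [hes] at h1
      rw [sub_eq_zero.1 h1, detTerm_succ]
      simp only [hq]
      rw [ih (by lia)]
      ring
  refine ⟨h - b 0 • t, hh.sub (ht.const_smul _), b 0, ?_⟩
  rw [heq, map_sub, map_smul, smul_add, Finset.smul_sum, ← add_assoc, sub_add_cancel]
  congr 1
  refine Finset.sum_congr rfl fun j hj => ?_
  rw [hb j (Finset.mem_range.1 hj), smul_smul]

theorem hasEigenvalue_iff_ruelleDet_eq_zero {c : ℝ} (hc : c < -2) {l : ℂ} (hl : l ≠ 0) :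
    (ruelle c hc).HasEigenvalue l⁻¹ ↔ ruelleDet c l = 0 := by
  rw [hasEigenvalue_ruelle_iff]
  constructor
  · rintro ⟨v, hv, hv0, heig⟩
    have hl' := norm_nonneg l
    have hR : -c < ‖l‖ - c + 2 := by linarith
    obtain ⟨u, hu, b, rfl⟩ := eigengerm_eq hc hR hl hv heig
    have hzero : toGerm c (u - l • regTransfer c u)
        + ∑ j ∈ Finset.range 1, (b * ruelleDet c l - l * (u 0 / 2)) •
          toGerm c (pole (crit c j)) = 0 := by
      have h1 : l • germTransfer c (toGerm c u + b • toGerm c (cauchySeries c l))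
          = toGerm c u + b • toGerm c (cauchySeries c l) := by
        rw [heig, smul_smul, mul_inv_cancel₀ hl, one_smul]
      rw [map_add, smul_add, map_smul, smul_comm, smul_germTransfer_cauchySeries hc,
        germTransfer_eq_regTransfer hc, ← sub_eq_zero] at h1
      rw [Finset.sum_range_one, map_sub, map_smul, sub_smul, mul_smul, mul_smul, ← neg_eq_zero,
        ← h1, smul_add, smul_sub]
      abel
    have hcoef := coeff_eq_zero_of_germ_eq_zero hc hR (N := 1) (fun j hj => by
      rw [Nat.lt_one_iff.1 hj, crit_zero, Complex.norm_real, Real.norm_eq_abs,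
        abs_of_neg (by linarith)]
      linarith) (hu.sub ((differentiableOn_regTransfer Metric.isOpen_ball
        (hu.mono (preimage_ball_subset hc hR))).const_smul l))
      (e := fun _ => b * ruelleDet c l - l * (u 0 / 2)) hzero 0 one_pos
    rw [hcoef] at hzero
    simp only [zero_smul, Finset.sum_const_zero, add_zero] at hzero
    rw [map_sub, map_smul, sub_eq_zero] at hzero
    obtain ⟨hu0, hug⟩ := toGerm_eq_zero_of_eq_regTransfer hc (by linarith) hu hzero
    rw [hu0, zero_div, mul_zero, sub_zero] at hcoef
    refine (mul_eq_zero.1 hcoef).resolve_left fun hb => hv0 ?_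
    rw [hug, hb, zero_smul, add_zero]
  · intro hD
    refine ⟨toGerm c (cauchySeries c l), ⟨_, analyticOnNhd_cauchySeries hc l, rfl⟩,
      toGerm_cauchySeries_ne_zero hc l, ?_⟩
    have h1 := smul_germTransfer_cauchySeries hc l
    rw [hD, zero_smul, sub_zero] at h1
    rw [← h1, smul_smul, inv_mul_cancel₀ hl, one_smul, h1]

end RuelleQuadratic

theorem mainTheorem5 (c : ℝ) (hc : c < -2) :
    (∀ (n : ℕ), 1 ≤ n → (RuelleQuadratic.quad c)^[n] 0 ≠ 0) ∧
    (∀ l : ℂ, Summable fun n : ℕ => RuelleQuadratic.detTerm c l (n + 1)) ∧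
    ∀ l : ℂ, l ≠ 0 →
      ((RuelleQuadratic.ruelle c hc).HasEigenvalue l⁻¹ ↔ RuelleQuadratic.ruelleDet c l = 0) := by
  refine ⟨fun n hn => ?_, fun l => ?_, fun l hl =>
    RuelleQuadratic.hasEigenvalue_iff_ruelleDet_eq_zero hc hl⟩
  · obtain ⟨j, rfl⟩ := Nat.exists_eq_add_of_le' hn
    exact RuelleQuadratic.crit_ne_zero hc j
  · exact (summable_nat_add_iff 1).2 (RuelleQuadratic.summable_norm_detTerm hc l).of_norm
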